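/- **Theorem 1 (Non-asymptotic bound).** *Setting.* Let $K\ge 2$ and let $\mathcal G^*$ be the set of $\mu\in[0,1]^K$ with a unique largest coordinate, whose index is denoted $a^*(\mu)$. A bandit $\mu\in\mathcal G^*$ is sampled sequentially: at each time $t\ge1$ an arm $A_t\in\{1,\dots,K\}$ is chosen from the past, and a reward $Y_t$ is observed which, given the past and $A_t$, is distributed as $\mathcal N(\mu_{A_t},1)$. Write $\Sigma_K$ for the probability simplex and $$T(\mu)^{-1}=\sup_{v\in\Sigma_K}\ \inf_{\lambda\in\mathcal G^*:\,a^*(\lambda)\ne a^*(\mu)}\ \sum_{a}v_a\frac{(\mu_a-\lambda_a)^2}{2},$$ let $w(\mu)$ be the unique maximizer $v$, and $w_{\min}(\mu)=\min_a w_a(\mu)$. For a vector $\nu\in\mathbb R^K$ with a unique largest coordinate, $w(\nu)$ denotes the maximizer of the same problem with $\lambda$ ranging over all vectors of $\mathbb R^K$ whose largest coordinate is unique and at an index other than that of $\nu$ (this agrees with the above when $\nu\in\mathcal G^*$). *Algorithm (Exploration-Biased Sampling with confidence parameter $\gamma$).* Let $N_a(t)$ be the number of draws of arm $a$ up to time $t$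 and $\hat\mu_a(t)$ the empirical mean of its rewards. Each arm is drawn once during the first $K$ rounds, and $\tilde w(s)=(1/K,\dots,1/K)$ for $s<K$. For $t\ge K$, let $\underline\mu_a,\overline\mu_a=\hat\mu_a(t)\mp C_{\gamma/K}(N_a(t))$ with $C_\gamma(s)=2\sqrt{\log(4s/\gamma)/s}$. If $\min_a\overline\mu_a\ge\max_a\underline\mu_a$, set $\tilde w(t)=(1/K,\dots,1/K)$. Otherwise, for each arm $a$ with $\overline\mu_a>\max_b\underline\mu_b$, let $\nu^{(a)}$ be the vector with $\nu^{(a)}_a=\overline\mu_a$ and $\nu^{(a)}_b=\max(\underline\mu_b,\min_c\overline\mu_c)$ for $b\neq a$, and let $\tilde w(t)=w(\nu^{(a)})$ for such an $a$ with the largest value of $\min_b w_b(\nu^{(a)})$. Then $A_{t+1}\in\operatorname{argmin}_a\bigl(N_a(t)-\sum_{s=1}^t\tilde w_a(s)\bigr)$. Ties are broken arbitrarily (without looking at future rewards). With $$Z(t)=\max_a\min_{b\ne a}\tfrac12\tfrac{N_a(t)N_b(t)}{N_a(t)+N_b(t)}\bigl(\hat\mu_a(t)-\hat\mu_b(t)\bigr)\bigl|\hat\mu_a(t)-\hat\mu_b(t)\bigr|,$$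 the algorithm with risk $\delta$ and threshold $\beta(t,\delta)=\log(Rt^\alpha/\delta)$ stops at $\tau_\delta=\inf\{t\ge K: Z(t)>\beta(t,\delta)\}$. The sampling rule does not depend on $\delta$; it is continued forever, so that all the $\tau_\delta$ are defined on the same process. *Statement.* Fix $\gamma\in(0,1)$, $\alpha\in[1,2]$, $\eta\in(0,1]$, a constant $R>0$ and $\mu\in\mathcal G^*$, and write $T=T(\mu)$, $w_{\min}=w_{\min}(\mu)$. There exist $\delta_0>0$, depending only on $\mu,K,\gamma,\eta,\alpha,R$, and an event $\mathcal E$ with $\mathbb P_\mu(\mathcal E)\ge1-\gamma$ (the same for all $\delta$), such that for every $0<\delta\le\delta_0$ $$\mathbb P_\mu(\{\tau_\delta>t\}\cap\mathcal E)\le 2Kt\exp\Bigl(-\frac{t\,w_{\min}}{4T^2}\,\frac1{\log^{2/3}(1/\delta)}\Bigr)\qquad\text{for all integers } t>(1+\eta)T\log(1/\delta),$$ and $$\mathbb E_\mu[\tau_\delta\mathbf 1_{\mathcal E}]\le(1+\eta)T\log(1/\delta)+\frac{2^7KT^4}{w_{\min}^2}\exp\Bigl(-\frac{w_{\min}}{4T}\log^{1/3}(1/\delta)\Bigr)\log^2(1/\delta).$$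 -/

import Mathlib

open MeasureTheory ProbabilityTheory

noncomputable section

namespace GaussianBAI

/-! ### Bandits, alternatives, characteristic time and optimal weights

A Gaussian bandit with `K` arms of unit variance is identified with its vector of means
`μ : Fin K → ℝ`. -/

/-- `a` is the unique arm of maximal mean. -/
def IsUniqueBest {K : ℕ} (μ : Fin K → ℝ) (a : Fin K) : Prop :=
  ∀ b, b ≠ a → μ b < μ a

/-- Bandits with all their means in `I` and exactly one best arm. The class of the theorem is
obtained for `I = [0, 1]`. -/
def uniqueBestBandits (K : ℕ) (I : Set ℝ) : Set (Fin K → ℝ) :=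
  {μ | (∀ a, μ a ∈ I) ∧ ∃ a, IsUniqueBest μ a}

/-- Bandits with means in `I` and a unique best arm that is not the best arm of `μ`. -/
def alternatives {K : ℕ} (I : Set ℝ) (μ : Fin K → ℝ) : Set (Fin K → ℝ) :=
  {l | (∀ a, l a ∈ I) ∧ ∃ a, IsUniqueBest l a ∧ ¬ IsUniqueBest μ a}

/-- `inf_{λ ∈ Alt(μ)} ∑_a v_a (μ_a - λ_a)² / 2`. -/
def altCost {K : ℕ} (I : Set ℝ) (μ v : Fin K → ℝ) : ℝ :=
  ⨅ l : alternatives I μ, ∑ a, v a * ((μ a - (l : Fin K → ℝ) a) ^ 2 / 2)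

/-- The characteristic time, `T(μ)⁻¹ = sup_{v ∈ Σ_K} inf_{λ ∈ Alt(μ)} ∑_a v_a (μ_a - λ_a)² / 2`. -/
def charTime {K : ℕ} (I : Set ℝ) (μ : Fin K → ℝ) : ℝ :=
  (⨆ v : stdSimplex ℝ (Fin K), altCost I μ (v : Fin K → ℝ))⁻¹

open Classical in
/-- The optimal weights `w(μ)`: the maximizer over the simplex of the problem defining `T(μ)` when
the best arm of `μ` is unique, and the uniform distribution on the best arms otherwise. -/
def optWeights {K : ℕ} (I : Set ℝ) (μ : Fin K → ℝ) : Fin K → ℝ :=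
  if ∃ a, IsUniqueBest μ a then
    Classical.epsilon fun v : Fin K → ℝ =>
      v ∈ stdSimplex ℝ (Fin K) ∧ ∀ u ∈ stdSimplex ℝ (Fin K), altCost I μ u ≤ altCost I μ v
  else fun a =>
    if ∀ b, μ b ≤ μ a then ((Finset.univ.filter fun c => ∀ b, μ b ≤ μ c).card : ℝ)⁻¹ else 0

/-- The smallest entry of a weight vector. -/
def minWeight {K : ℕ} (w : Fin K → ℝ) : ℝ := ⨅ a, w a

/-! ### Exploration-biased weights of a product of intervals `∏_a [lo_a, up_a]` -/

/-- The bandit tried when `a` is assumed to be the best arm: `up_a` for arm `a` and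
`max (lo_b) (min_c up_c)` for every other arm `b`. -/
def testBandit {K : ℕ} (lo up : Fin K → ℝ) (a : Fin K) : Fin K → ℝ :=
  fun b => if b = a then up a else max (lo b) (⨅ c, up c)

/-- The arms whose upper bound exceeds all lower bounds. -/
def potentialBest {K : ℕ} (lo up : Fin K → ℝ) : Set (Fin K) :=
  {a | (⨆ b, lo b) < up a}

/-- `w` is a possible output of Exploration-Biased Weights on `∏_a [lo_a, up_a]`: uniform if the
intervals have a common point, and otherwise the optimal weights of a test bandit with the largest
minimal weight. Ties are free, so that the arms may be scanned in any order. The intervals need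
not lie in `[0, 1]`, hence the optimal weights are those of the problem with unrestricted means
(for a bandit with means in `[0, 1]` the two problems have the same solution). -/
def IsExplorationBiasedWeights {K : ℕ} (lo up w : Fin K → ℝ) : Prop :=
  ((⨆ a, lo a) ≤ (⨅ a, up a) ∧ w = fun _ => 1 / (K : ℝ)) ∨
  ((⨅ a, up a) < (⨆ a, lo a) ∧
    ∃ a ∈ potentialBest lo up,
      (∀ b ∈ potentialBest lo up,
        minWeight (optWeights Set.univ (testBandit lo up b)) ≤
          minWeight (optWeights Set.univ (testBandit lo up a))) ∧
      w = optWeights Set.univ (testBandit lo up a))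

/-! ### Statistics of a sampling process

`A t` is the arm drawn and `Y t` the reward observed at time `t ≥ 1`; the values at time `0` play
no role. -/

/-- The number of draws of arm `a` up to time `t`. -/
def draws {K : ℕ} {Ω : Type*} (A : ℕ → Ω → Fin K) (t : ℕ) (ω : Ω) (a : Fin K) : ℕ :=
  ((Finset.Icc 1 t).filter fun s => A s ω = a).card

/-- The empirical mean of arm `a` at time `t`. -/
def empMean {K : ℕ} {Ω : Type*} (A : ℕ → Ω → Fin K) (Y : ℕ → Ω → ℝ) (t : ℕ) (ω : Ω)
    (a : Fin K) : ℝ :=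
  (∑ s ∈ (Finset.Icc 1 t).filter (fun s => A s ω = a), Y s ω) / (draws A t ω a : ℝ)

/-- The half-width `C_γ(s) = 2 √(log (4 s / γ) / s)`. -/
def confWidth (γ s : ℝ) : ℝ := 2 * √(Real.log (4 * s / γ) / s)

/-- The lower ends of the confidence intervals at time `t`. -/
def lowerConf {K : ℕ} {Ω : Type*} (γ : ℝ) (A : ℕ → Ω → Fin K) (Y : ℕ → Ω → ℝ) (t : ℕ) (ω : Ω)
    (a : Fin K) : ℝ :=
  empMean A Y t ω a - confWidth (γ / K) (draws A t ω a)

/-- The upper ends of the confidence intervals at time `t`. -/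
def upperConf {K : ℕ} {Ω : Type*} (γ : ℝ) (A : ℕ → Ω → Fin K) (Y : ℕ → Ω → ℝ) (t : ℕ) (ω : Ω)
    (a : Fin K) : ℝ :=
  empMean A Y t ω a + confWidth (γ / K) (draws A t ω a)

/-- The generalized likelihood ratio statistic `Z_{a,b}(t)`. -/
def glrPair {K : ℕ} {Ω : Type*} (A : ℕ → Ω → Fin K) (Y : ℕ → Ω → ℝ) (t : ℕ) (ω : Ω)
    (a b : Fin K) : ℝ :=
  1 / 2 * ((draws A t ω a : ℝ) * (draws A t ω b : ℝ) /
      ((draws A t ω a : ℝ) + (draws A t ω b : ℝ))) *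
    (empMean A Y t ω a - empMean A Y t ω b) * |empMean A Y t ω a - empMean A Y t ω b|

/-- `Z(t) = max_a min_{b ≠ a} Z_{a,b}(t)`. -/
def glr {K : ℕ} {Ω : Type*} (A : ℕ → Ω → Fin K) (Y : ℕ → Ω → ℝ) (t : ℕ) (ω : Ω) : ℝ :=
  ⨆ a : Fin K, ⨅ b : {b : Fin K // b ≠ a}, glrPair A Y t ω a b

/-- The threshold `β(t, δ) = log (R t^α / δ)`. -/
def threshold (R α : ℝ) (t : ℕ) (δ : ℝ) : ℝ := Real.log (R * (t : ℝ) ^ α / δ)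

/-- The stopping time `τ_δ`: the first `t ≥ K` with `Z(t) > β(t, δ)` (`⊤` if there is none). -/
def stopTime {K : ℕ} {Ω : Type*} (A : ℕ → Ω → Fin K) (Y : ℕ → Ω → ℝ) (R α δ : ℝ) (ω : Ω) : ℕ∞ :=
  ⨅ t : {t : ℕ // K ≤ t ∧ threshold R α t δ < glr A Y t ω}, ((t : ℕ) : ℕ∞)

/-! ### Sampling a Gaussian bandit and the sampling rule -/

/-- `(A, Y)` is a sequential sampling of the bandit `μ`: the arm `A (t+1)` is chosen from the
information `ℱ t` available at time `t`, and given `ℱ t` the reward `Y (t+1)` is distributed as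
`N(μ_{A (t+1)}, 1)`; that is, `Y (t+1) - μ_{A (t+1)}` is a standard Gaussian variable independent
of `ℱ t`. (The filtration may contain a randomization used to break ties.) -/
structure IsBanditSampling {K : ℕ} {Ω : Type*} [mΩ : MeasurableSpace Ω] (P : Measure Ω)
    (μ : Fin K → ℝ) (ℱ : Filtration ℕ mΩ) (A : ℕ → Ω → Fin K) (Y : ℕ → Ω → ℝ) : Prop where
  measurable_arm : ∀ t, Measurable[ℱ t] (A (t + 1))
  measurable_reward : ∀ t, Measurable[ℱ (t + 1)] (Y (t + 1))
  noise_law : ∀ t, HasLaw (fun ω => Y (t + 1) ω - μ (A (t + 1) ω)) (gaussianReal 0 1) P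
  noise_indep : ∀ t,
    Indep (MeasurableSpace.comap (fun ω => Y (t + 1) ω - μ (A (t + 1) ω)) inferInstance) (ℱ t) P

/-- The sampling rule of Exploration-Biased Sampling with confidence parameter `γ`: every arm is
drawn once during the first `K` rounds, then an arm minimizing `N_a(t) - ∑_{s=1}^t w_a(s)` is
drawn, where `w(s)` is uniform for `s < K` and given by the exploration-biased weights of the
confidence region at time `s` for `s ≥ K`. All ways of breaking ties are allowed. The rule
does not depend on the risk `δ`, which only enters the stopping time; it is followed forever, so
that one process serves for all values of `δ`. -/
structure IsExplorationBiasedSampling {K : ℕ} {Ω : Type*} (γ : ℝ)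
    (A : ℕ → Ω → Fin K) (Y : ℕ → Ω → ℝ) (w : ℕ → Ω → Fin K → ℝ) : Prop where
  init_draws : ∀ ω a, draws A K ω a = 1
  init_weights : ∀ t < K, ∀ ω, w t ω = fun _ => 1 / (K : ℝ)
  weights : ∀ t, K ≤ t → ∀ ω,
    IsExplorationBiasedWeights (lowerConf γ A Y t ω) (upperConf γ A Y t ω) (w t ω)
  tracking : ∀ t, K ≤ t → ∀ ω b,
    (draws A t ω (A (t + 1) ω) : ℝ) - ∑ s ∈ Finset.Icc 1 t, w s ω (A (t + 1) ω) ≤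
      (draws A t ω b : ℝ) - ∑ s ∈ Finset.Icc 1 t, w s ω b

end GaussianBAI

end

/-! On the event that every confidence interval contains its mean, stopping before `(1 + η) T log
(1/δ)` is deterministic. Thus the probability in the first bound is zero, and in the second bound
the first term suffices: only the nonnegativity of the exponential terms is used.

For nonnegative weights `v`, the cost of the alternatives to a bandit `ν` with best arm `a` is the
minimum over `b ≠ a` of `harm (v a) (v b) * (ν a - ν b)² / 2` (`altCost_le`, `le_altCost`), whether
the means are restricted to `[0, 1]` or not. Hence optimal weights are bounded below in terms of the
ratio of the gaps (`le_optWeights`), and those of a nearby bandit are nearly optimal for `μ`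
(`optWeights_nearly_optimal`). Only their maximality matters, not their uniqueness.

On the confidence event the weights, being the most exploratory ones compatible with the intervals,
stay above a constant depending on `μ` and `K`. Tracking then makes every arm drawn linearly often,
so after a deterministic time all intervals are short and the weights nearly optimal. Since `harm`
is superadditive, this passes to the counts, and `Z(t) ≥ t (1/T - ε)` (`exists_le_glr`), which beats
the logarithmic threshold (`exists_threshold_lt`).

The confidence event has probability at least `1 - γ`: for each number `s` of draws, an exponential
martingale frozen at the `s`-th draw bounds the deviation, and the bounds are summed over `s`, both
signs and the arms. -/

namespace GaussianBAI

/-! ### Half of the harmonic mean -/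

/-- `x y / (x + y)`. -/
noncomputable def harm (x y : ℝ) : ℝ := x * y / (x + y)

theorem harm_nonneg {x y : ℝ} (hx : 0 ≤ x) (hy : 0 ≤ y) : 0 ≤ harm x y := by
  unfold harm; positivity

theorem harm_comm (x y : ℝ) : harm x y = harm y x := by
  unfold harm; rw [mul_comm, add_comm]

theorem harm_le_left {x y : ℝ} (hx : 0 ≤ x) (hy : 0 ≤ y) : harm x y ≤ x :=
  div_le_of_le_mul₀ (by positivity) hx (by nlinarith)

theorem harm_le_right {x y : ℝ} (hx : 0 ≤ x) (hy : 0 ≤ y) : harm x y ≤ y := by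
  rw [harm_comm]; exact harm_le_left hy hx

/-- The minimum of `x p² + y q²` when `p - q` is fixed. -/
theorem harm_mul_sq_le {x y : ℝ} (hx : 0 ≤ x) (hy : 0 ≤ y) (p q : ℝ) :
    harm x y * (p - q) ^ 2 ≤ x * p ^ 2 + y * q ^ 2 := by
  unfold harm
  rcases (add_nonneg hx hy).eq_or_lt with h | h
  · rw [← h]; simp; positivity
  · rw [div_mul_eq_mul_div, div_le_iff₀ h]
    nlinarith [sq_nonneg (x * p + y * q)]

/-- As a minimum over `p - q = 1` of the linear forms `x p² + y q²`, `harm` is superadditive: it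
suffices to evaluate both summands at the minimizer of the sum. -/
theorem harm_superadd {x y x' y' : ℝ} (hx : 0 ≤ x) (hy : 0 ≤ y) (hx' : 0 ≤ x') (hy' : 0 ≤ y') :
    harm x y + harm x' y' ≤ harm (x + x') (y + y') := by
  rcases (add_nonneg (add_nonneg hx hx') (add_nonneg hy hy')).eq_or_lt with h | h
  · obtain rfl : x = 0 := by linarith
    obtain rfl : x' = 0 := by linarith
    simp [harm]
  · set X := x + x' with hX
    set Z := y + y' with hZ
    have h1 := harm_mul_sq_le hx hy (Z / (X + Z)) (-(X / (X + Z)))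
    have h2 := harm_mul_sq_le hx' hy' (Z / (X + Z)) (-(X / (X + Z)))
    have h3 : Z / (X + Z) - -(X / (X + Z)) = 1 := by field_simp; ring
    rw [h3] at h1 h2
    have h4 : X * (Z / (X + Z)) ^ 2 + Z * (-(X / (X + Z))) ^ 2 = harm X Z := by
      unfold harm; field_simp; ring
    rw [← h4, hX, hZ]
    rw [hX, hZ] at h1 h2
    linarith

theorem harm_mono {x y x' y' : ℝ} (hx : 0 ≤ x) (hy : 0 ≤ y) (hx' : x ≤ x') (hy' : y ≤ y') :
    harm x y ≤ harm x' y' := by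
  have h := harm_superadd hx hy (sub_nonneg.2 hx') (sub_nonneg.2 hy')
  have h' := harm_nonneg (sub_nonneg.2 hx') (sub_nonneg.2 hy')
  simp only [add_sub_cancel] at h
  linarith

/-- The derivative of `harm` along the diagonal is `p² + q²` with `p, q ≥ 0` and `p + q = 1`, hence
at most `1`. This absorbs the tracking errors of two arms at once. -/
theorem harm_add_le {x y k : ℝ} (hx : 0 ≤ x) (hy : 0 ≤ y) (hk : 0 ≤ k) :
    harm (x + k) (y + k) ≤ harm x y + k := by
  rcases (add_nonneg hx hy).eq_or_lt with h | h
  · obtain rfl : x = 0 := by linarith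
    obtain rfl : y = 0 := by linarith
    have := harm_le_left (x := 0 + k) (y := 0 + k) (by linarith) (by linarith)
    simpa [harm] using this
  · unfold harm
    rw [div_add' _ _ _ h.ne', div_le_div_iff₀ (by linarith) h]
    nlinarith [mul_nonneg (mul_nonneg hx hy) hk, mul_nonneg (mul_nonneg hx hk) hk,
      mul_nonneg (mul_nonneg hy hk) hk, mul_nonneg (mul_nonneg hx hx) hk,
      mul_nonneg (mul_nonneg hy hy) hk]

theorem sum_harm_le {ι : Type*} (s : Finset ι) {f g : ι → ℝ} (hf : ∀ i ∈ s, 0 ≤ f i)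
    (hg : ∀ i ∈ s, 0 ≤ g i) :
    ∑ i ∈ s, harm (f i) (g i) ≤ harm (∑ i ∈ s, f i) (∑ i ∈ s, g i) := by
  classical
  induction s using Finset.induction_on with
  | empty => simp [harm]
  | insert i s hi ih =>
    rw [Finset.sum_insert hi, Finset.sum_insert hi, Finset.sum_insert hi]
    have h1 := ih (fun j hj => hf j (Finset.mem_insert_of_mem hj))
      (fun j hj => hg j (Finset.mem_insert_of_mem hj))
    have h2 := harm_superadd (hf i (Finset.mem_insert_self _ _)) (hg i (Finset.mem_insert_self _ _))
      (Finset.sum_nonneg fun j hj => hf j (Finset.mem_insert_of_mem hj))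
      (Finset.sum_nonneg fun j hj => hg j (Finset.mem_insert_of_mem hj))
    linarith

/-! ### The cost of the alternatives -/

theorem IsUniqueBest.unique {K : ℕ} {ν : Fin K → ℝ} {a b : Fin K} (ha : IsUniqueBest ν a)
    (hb : IsUniqueBest ν b) : a = b := by
  by_contra h
  exact lt_asymm (ha b (Ne.symm h)) (hb a h)

theorem bddBelow_altCost {K : ℕ} (I : Set ℝ) (ν : Fin K → ℝ) {v : Fin K → ℝ} (hv : ∀ a, 0 ≤ v a) :
    BddBelow (Set.range fun l : alternatives I ν =>
      ∑ a, v a * ((ν a - (l : Fin K → ℝ) a) ^ 2 / 2)) := by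
  refine ⟨0, ?_⟩
  rintro _ ⟨l, rfl⟩
  exact Finset.sum_nonneg fun a _ => mul_nonneg (hv a) (by positivity)

/-- A bandit of which some arm `c ≠ a` is among the best is a limit of bandits with `c` as unique
best arm. -/
theorem perturb_mem_alternatives {K : ℕ} {I : Set ℝ} (hI : Convex ℝ I) (h0 : (0 : ℝ) ∈ I)
    (h1 : (1 : ℝ) ∈ I) {ν : Fin K → ℝ} {a c : Fin K} (ha : IsUniqueBest ν a) (hca : c ≠ a)
    {l : Fin K → ℝ} (hl : ∀ d, l d ∈ I) (hc : ∀ d, l d ≤ l c) {ε : ℝ} (hε : 0 < ε)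
    (hε1 : ε ≤ 1) :
    (fun d => (1 - ε) * l d + ε * (if d = c then 1 else 0)) ∈ alternatives I ν := by
  refine ⟨fun d => ?_, c, fun d hd => ?_, fun h => hca (h.unique ha)⟩
  · refine hI (hl d) ?_ (by linarith) hε.le (by ring)
    split_ifs
    exacts [h1, h0]
  · simp only [hd, if_true, if_false]
    nlinarith [mul_le_mul_of_nonneg_left (hc d) (by linarith : 0 ≤ 1 - ε)]

theorem nonempty_alternatives {K : ℕ} {I : Set ℝ} (hI : Convex ℝ I) (h0 : (0 : ℝ) ∈ I)
    (h1 : (1 : ℝ) ∈ I) {ν : Fin K → ℝ} {a b : Fin K} (ha : IsUniqueBest ν a) (hb : b ≠ a) :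
    (alternatives I ν).Nonempty :=
  ⟨_, perturb_mem_alternatives hI h0 h1 ha hb (l := fun _ => 0) (fun _ => h0) (fun _ => le_rfl)
    one_pos le_rfl⟩

/-- The cheapest way to let `b` catch up with `a` is to move both to their weighted mean `m`. The
result may have ties, but some arm other than `a` is among its best, so it is a limit of
alternatives and the cost is continuous. -/
theorem altCost_le {K : ℕ} {I : Set ℝ} (hI : Convex ℝ I) (h0 : (0 : ℝ) ∈ I)
    (h1 : (1 : ℝ) ∈ I) {ν : Fin K → ℝ} (hν : ∀ a, ν a ∈ I) {a b : Fin K}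
    (ha : IsUniqueBest ν a) (hb : b ≠ a) {v : Fin K → ℝ} (hv : ∀ a, 0 ≤ v a) :
    altCost I ν v ≤ harm (v a) (v b) * (ν a - ν b) ^ 2 / 2 := by
  obtain ⟨m, hm, hcost⟩ : ∃ m ∈ I, v a * ((ν a - m) ^ 2 / 2) + v b * ((ν b - m) ^ 2 / 2) =
      harm (v a) (v b) * (ν a - ν b) ^ 2 / 2 := by
    rcases (add_nonneg (hv a) (hv b)).eq_or_lt with h | h
    · have hva : v a = 0 := by linarith [hv a, hv b]
      have hvb : v b = 0 := by linarith [hv a, hv b]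
      -- With no weight on `a` and `b`, any common value in `I` costs nothing.
      exact ⟨ν a, hν a, by simp [harm, hva, hvb]⟩
    · refine ⟨v a / (v a + v b) * ν a + v b / (v a + v b) * ν b, ?_, ?_⟩
      · exact hI (hν a) (hν b) (div_nonneg (hv a) h.le) (div_nonneg (hv b) h.le) (by field_simp)
      · unfold harm; field_simp; ring
  set l : Fin K → ℝ := fun d => if d = a ∨ d = b then m else ν d with hl
  have hlI : ∀ d, l d ∈ I := fun d => by
    simp only [hl]; split_ifs
    exacts [hm, hν d]
  obtain ⟨c, hca, hc⟩ : ∃ c, c ≠ a ∧ ∀ d, l d ≤ l c := by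
    have : Nonempty (Fin K) := ⟨a⟩
    obtain ⟨c, hc⟩ := Finite.exists_max l
    -- If the maximum is reached at `a`, it is also reached at `b`, which has the same value `m`.
    by_cases h : c = a
    · refine ⟨b, hb, fun d => (hc d).trans ?_⟩
      simp [hl, h]
    · exact ⟨c, h, hc⟩
  have hsum : ∑ d, v d * ((ν d - l d) ^ 2 / 2) = harm (v a) (v b) * (ν a - ν b) ^ 2 / 2 := by
    rw [← hcost, Fintype.sum_eq_add a b hb.symm]
    · simp [hl]
    · rintro d ⟨hda, hdb⟩
      simp [hl, hda, hdb]
  rw [← hsum]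
  set f : ℝ → ℝ := fun ε => ∑ d, v d * ((ν d -
    ((1 - ε) * l d + ε * (if d = c then 1 else 0))) ^ 2 / 2) with hf
  have hcont : Filter.Tendsto f (nhdsWithin 0 (Set.Ioi 0)) (nhds (f 0)) :=
    (Continuous.tendsto (by fun_prop) 0).mono_left nhdsWithin_le_nhds
  have hf0 : f 0 = ∑ d, v d * ((ν d - l d) ^ 2 / 2) := by simp [hf]
  rw [← hf0]
  refine ge_of_tendsto hcont ?_
  filter_upwards [Ioc_mem_nhdsGT (zero_lt_one' ℝ)] with ε hε
  exact ciInf_le (bddBelow_altCost I ν hv)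
    ⟨_, perturb_mem_alternatives hI h0 h1 ha hca hlI hc hε.1 hε.2⟩

/-- In an alternative some `b` beats `a`. Dropping all other arms, the displacements of `a` and `b`
differ by at least the gap `ν a - ν b`, and `harm` gives the minimal cost. Nonemptiness is needed
because an empty infimum is `0`. -/
theorem le_altCost {K : ℕ} {I : Set ℝ} {ν : Fin K → ℝ} (hne : (alternatives I ν).Nonempty)
    {a : Fin K} (ha : IsUniqueBest ν a) {v : Fin K → ℝ} (hv : ∀ a, 0 ≤ v a) {x : ℝ}
    (hx : ∀ b, b ≠ a → x ≤ harm (v a) (v b) * (ν a - ν b) ^ 2 / 2) :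
    x ≤ altCost I ν v := by
  have := hne.to_subtype
  refine le_ciInf ?_
  rintro ⟨l, -, b, hb, hνb⟩
  have hba : b ≠ a := by rintro rfl; exact hνb ha
  refine (hx b hba).trans ?_
  have h1 := Finset.sum_le_sum_of_subset_of_nonneg (Finset.subset_univ {a, b})
    (f := fun d => v d * ((ν d - l d) ^ 2 / 2))
    fun d _ _ => mul_nonneg (hv d) (by positivity)
  rw [Finset.sum_pair hba.symm] at h1
  refine le_trans ?_ h1
  have h2 := harm_mul_sq_le (hv a) (hv b) (ν a - l a) (ν b - l b)
  have h3 : (ν a - ν b) ^ 2 ≤ (ν a - l a - (ν b - l b)) ^ 2 := by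
    have := ha b hba
    have := hb a hba.symm
    apply pow_le_pow_left₀ <;> linarith
  have h4 := mul_le_mul_of_nonneg_left h3 (harm_nonneg (hv a) (hv b))
  linarith

/-- An infimum of linear functions of `v` is upper semicontinuous, and the simplex is compact. The
arm `a` only shows that the simplex is nonempty. -/
theorem exists_altCost_max {K : ℕ} (I : Set ℝ) (ν : Fin K → ℝ) (a : Fin K)
    (hne : (alternatives I ν).Nonempty) :
    ∃ v : Fin K → ℝ, v ∈ stdSimplex ℝ (Fin K) ∧
      ∀ u ∈ stdSimplex ℝ (Fin K), altCost I ν u ≤ altCost I ν v := by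
  have := hne.to_subtype
  have husc : UpperSemicontinuousOn (altCost I ν) (stdSimplex ℝ (Fin K)) := by
    refine upperSemicontinuousOn_ciInf (fun v hv => bddBelow_altCost I ν hv.1) fun l => ?_
    exact (Continuous.upperSemicontinuous (by fun_prop)).upperSemicontinuousOn _
  obtain ⟨v, hv, hmax⟩ := husc.exists_isMaxOn ⟨_, single_mem_stdSimplex ℝ a⟩
    (isCompact_stdSimplex ℝ (Fin K))
  exact ⟨v, hv, fun u hu => hmax hu⟩

theorem optWeights_spec {K : ℕ} (I : Set ℝ) {ν : Fin K → ℝ} {a : Fin K} (ha : IsUniqueBest ν a)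
    (hne : (alternatives I ν).Nonempty) :
    optWeights I ν ∈ stdSimplex ℝ (Fin K) ∧
      ∀ u ∈ stdSimplex ℝ (Fin K), altCost I ν u ≤ altCost I ν (optWeights I ν) := by
  have h : ∃ a, IsUniqueBest ν a := ⟨a, ha⟩
  unfold optWeights
  rw [if_pos h]
  exact Classical.epsilon_spec (exists_altCost_max I ν a hne)

theorem nonempty_alternatives_univ {K : ℕ} {ν : Fin K → ℝ} {a b : Fin K} (ha : IsUniqueBest ν a)
    (hb : b ≠ a) : (alternatives Set.univ ν).Nonempty :=
  nonempty_alternatives convex_univ (Set.mem_univ _) (Set.mem_univ _) ha hb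

/-- Optimal weights do not fall below a constant depending on the ratio of the gaps only. -/
theorem le_optWeights {K : ℕ} (hK : 2 ≤ K) {ν : Fin K → ℝ} {a : Fin K} (ha : IsUniqueBest ν a)
    {r D : ℝ} (hr : 0 ≤ r) (hD : 0 < D) (hrD : ∀ b, b ≠ a → r * D ≤ ν a - ν b)
    (hDle : ∀ b, b ≠ a → ν a - ν b ≤ D) (c : Fin K) :
    r ^ 2 / (2 * K) ≤ optWeights Set.univ ν c := by
  have hK0 : (0 : ℝ) < K := by positivity
  have : Nontrivial (Fin K) := Fin.nontrivial_iff_two_le.2 hK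
  obtain ⟨b₀, hb₀⟩ := exists_ne a
  have hne := nonempty_alternatives_univ ha hb₀
  obtain ⟨hmem, hmax⟩ := optWeights_spec Set.univ ha hne
  set w := optWeights Set.univ ν
  have hu : (fun _ => 1 / (K : ℝ)) ∈ stdSimplex ℝ (Fin K) :=
    ⟨fun _ => by positivity, by simp; field_simp⟩
  -- The uniform weights are the competitor: their cost bounds the optimal one from below.
  have hlow : (r * D) ^ 2 / (4 * K) ≤ altCost Set.univ ν w := by
    refine le_trans (le_altCost hne ha hu.1 fun b hb => ?_) (hmax _ hu)
    have h1 : harm (1 / (K : ℝ)) (1 / K) = 1 / (2 * K) := by unfold harm; field_simp; norm_num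
    have h2 : (r * D) ^ 2 ≤ (ν a - ν b) ^ 2 := pow_le_pow_left₀ (by positivity) (hrD b hb) 2
    rw [h1, show (r * D) ^ 2 / (4 * (K : ℝ)) = 1 / (2 * K) * (r * D) ^ 2 / 2 by field_simp; norm_num]
    gcongr
  have key : ∀ b, b ≠ a → r ^ 2 / (2 * K) ≤ harm (w a) (w b) := fun b hb => by
    have h1 := hlow.trans (altCost_le convex_univ (Set.mem_univ _) (Set.mem_univ _)
      (fun _ => Set.mem_univ _) ha hb hmem.1)
    have h2 : (ν a - ν b) ^ 2 ≤ D ^ 2 := pow_le_pow_left₀ (sub_nonneg.2 (ha b hb).le) (hDle b hb) 2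
    have h3 := mul_le_mul_of_nonneg_left h2 (harm_nonneg (hmem.1 a) (hmem.1 b))
    have h4 : r ^ 2 / (2 * K) * D ^ 2 ≤ harm (w a) (w b) * D ^ 2 := by
      have : r ^ 2 / (2 * K) * D ^ 2 = 2 * ((r * D) ^ 2 / (4 * (K : ℝ))) := by
        field_simp; norm_num
      linarith
    exact le_of_mul_le_mul_right h4 (by positivity)
  by_cases hc : c = a
  · rw [hc]
    exact (key b₀ hb₀).trans (harm_le_left (hmem.1 a) (hmem.1 b₀))
  · exact (key c hc).trans (harm_le_right (hmem.1 a) (hmem.1 c))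

theorem sq_sub_sq_le {x y κ : ℝ} (hy0 : 0 ≤ y) (hy1 : y ≤ 1) (hκ1 : κ ≤ 1)
    (h : |x - y| ≤ κ) : |x ^ 2 - y ^ 2| ≤ 3 * κ := by
  have h1 : x ^ 2 - y ^ 2 = (x - y) * (x + y) := by ring
  have h2 : |x + y| ≤ 3 := by
    rw [abs_le] at h ⊢
    constructor <;> linarith
  rw [h1, abs_mul, mul_comm]
  exact mul_le_mul h2 h (abs_nonneg _) (by norm_num)

/-- The optimal weights of a bandit close to `μ` are nearly optimal for `μ`. -/
theorem optWeights_nearly_optimal {K : ℕ} {μ ν : Fin K → ℝ} {a b : Fin K}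
    (hμ01 : ∀ c, μ c ∈ Set.Icc (0 : ℝ) 1) (hμ : IsUniqueBest μ a) (hν : IsUniqueBest ν a)
    (hb : b ≠ a) {κ : ℝ} (hκ : κ ≤ 1)
    (hclose : ∀ c, c ≠ a → |(ν a - ν c) - (μ a - μ c)| ≤ κ) {v : Fin K → ℝ}
    (hv : v ∈ stdSimplex ℝ (Fin K)) :
    altCost (Set.Icc 0 1) μ v - 3 * κ ≤
      harm (optWeights Set.univ ν a) (optWeights Set.univ ν b) * (μ a - μ b) ^ 2 / 2 := by
  have hne := nonempty_alternatives_univ hν hb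
  obtain ⟨hmem, hmax⟩ := optWeights_spec Set.univ hν hne
  set w := optWeights Set.univ ν
  have hsq : ∀ c, c ≠ a → |(ν a - ν c) ^ 2 - (μ a - μ c) ^ 2| ≤ 3 * κ := fun c hc =>
    sq_sub_sq_le (sub_nonneg.2 (hμ c hc).le) (by linarith [(hμ01 a).2, (hμ01 c).1]) hκ (hclose c hc)
  have hharm : ∀ u ∈ stdSimplex ℝ (Fin K), ∀ c d, harm (u c) (u d) ≤ 1 := fun u hu c d =>
    (harm_le_left (hu.1 c) (hu.1 d)).trans (mem_Icc_of_mem_stdSimplex hu c).2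
  have hκ0 : 0 ≤ κ := (abs_nonneg _).trans (hclose b hb)
  -- Squared gaps change by at most `3κ` and `harm ≤ 1` on the simplex, so each change of bandit
  -- costs `3κ/2`; it is paid twice, for `v` and for `w`.
  have h1 : altCost (Set.Icc 0 1) μ v - 3 / 2 * κ ≤ altCost Set.univ ν v := by
    refine le_altCost hne hν hv.1 fun c hc => ?_
    have h2 := altCost_le (convex_Icc 0 1) (by simp) (by simp) hμ01 hμ hc hv.1
    have h3 := (abs_le.1 (hsq c hc)).1
    nlinarith [hharm v hv a c, harm_nonneg (hv.1 a) (hv.1 c)]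
  have h2 := altCost_le convex_univ (Set.mem_univ _) (Set.mem_univ _)
      (fun _ => Set.mem_univ _) hν hb hmem.1
  have h3 := (abs_le.1 (hsq b hb)).2
  have h4 := hmax v hv
  nlinarith [hharm w hmem a b, harm_nonneg (hmem.1 a) (hmem.1 b)]

/-- The characteristic time is positive, and its inverse is the supremum of the costs. -/
theorem charTime_pos {K : ℕ} (hK : 2 ≤ K) {μ : Fin K → ℝ} {a : Fin K} (hμ : IsUniqueBest μ a) :
    0 < charTime (Set.Icc 0 1) μ ∧ ∃ v ∈ stdSimplex ℝ (Fin K),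
      altCost (Set.Icc 0 1) μ v = (charTime (Set.Icc 0 1) μ)⁻¹ := by
  have : Nontrivial (Fin K) := Fin.nontrivial_iff_two_le.2 hK
  obtain ⟨b₀, hb₀⟩ := exists_ne a
  have hne := nonempty_alternatives (convex_Icc (0 : ℝ) 1) (by simp) (by simp) hμ hb₀
  obtain ⟨v, hv, hmax⟩ := exists_altCost_max (Set.Icc 0 1) μ a hne
  have hsup : (⨆ v : stdSimplex ℝ (Fin K), altCost (Set.Icc 0 1) μ (v : Fin K → ℝ)) =
      altCost (Set.Icc 0 1) μ v := by
    have : Nonempty (stdSimplex ℝ (Fin K)) := ⟨⟨v, hv⟩⟩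
    refine le_antisymm (ciSup_le fun u => hmax u u.2) ?_
    exact le_ciSup (f := fun u : stdSimplex ℝ (Fin K) => altCost (Set.Icc 0 1) μ (u : Fin K → ℝ))
      ⟨_, by rintro _ ⟨u, rfl⟩; exact hmax u u.2⟩ ⟨v, hv⟩
  have hK0 : (0 : ℝ) < K := by positivity
  have hu : (fun _ => 1 / (K : ℝ)) ∈ stdSimplex ℝ (Fin K) :=
    ⟨fun _ => by positivity, by simp; field_simp⟩
  obtain ⟨d, hd, hdle⟩ : ∃ d > 0, ∀ b, b ≠ a → d ≤ (μ a - μ b) ^ 2 := by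
    have : Nonempty {b // b ≠ a} := ⟨⟨b₀, hb₀⟩⟩
    obtain ⟨b, hb⟩ := Finite.exists_min fun b : {b // b ≠ a} => (μ a - μ b) ^ 2
    exact ⟨_, by have := sub_pos.2 (hμ b b.2); positivity, fun c hc => hb ⟨c, hc⟩⟩
  have hpos : 0 < altCost (Set.Icc 0 1) μ v := by
    refine lt_of_lt_of_le (b := 1 / (2 * K) * d / 2) (by positivity)
      (le_trans (le_altCost hne hμ hu.1 fun b hb => ?_) (hmax _ hu))
    have h1 : harm (1 / (K : ℝ)) (1 / K) = 1 / (2 * K) := by unfold harm; field_simp; norm_num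
    rw [h1]
    have := hdle b hb
    gcongr
  unfold charTime
  rw [hsup]
  exact ⟨inv_pos.2 hpos, v, hv, (inv_inv _).symm⟩

/-! ### Exploration-biased weights -/

theorem isUniqueBest_testBandit {K : ℕ} {lo up : Fin K → ℝ} {a : Fin K}
    (ha : a ∈ potentialBest lo up) (h : (⨅ c, up c) < ⨆ c, lo c) :
    IsUniqueBest (testBandit lo up a) a := by
  intro b hb
  have h1 : (⨆ c, lo c) < up a := ha
  have h2 : lo b ≤ ⨆ c, lo c := le_ciSup (Set.finite_range _).bddAbove b
  simp only [testBandit, hb, if_true, if_false]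
  exact max_lt (h2.trans_lt h1) (h.trans h1)

theorem uniform_mem_stdSimplex {K : ℕ} (hK : 2 ≤ K) :
    (fun _ => 1 / (K : ℝ)) ∈ stdSimplex ℝ (Fin K) := by
  have hK0 : (0 : ℝ) < K := by positivity
  exact ⟨fun _ => by positivity, by simp; field_simp⟩

theorem IsExplorationBiasedWeights.mem_stdSimplex {K : ℕ} (hK : 2 ≤ K) {lo up w : Fin K → ℝ}
    (h : IsExplorationBiasedWeights lo up w) : w ∈ stdSimplex ℝ (Fin K) := by
  have : Nontrivial (Fin K) := Fin.nontrivial_iff_two_le.2 hK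
  rcases h with ⟨-, rfl⟩ | ⟨hlt, a, ha, -, rfl⟩
  · exact uniform_mem_stdSimplex hK
  · obtain ⟨b, hb⟩ := exists_ne a
    have hbest := isUniqueBest_testBandit ha hlt
    exact (optWeights_spec _ hbest (nonempty_alternatives_univ hbest hb)).1

/-- Exploration-biased weights of a confidence region containing `μ` are bounded below. -/
theorem IsExplorationBiasedWeights.le {K : ℕ} (hK : 2 ≤ K) {μ : Fin K → ℝ}
    (hμ01 : ∀ c, μ c ∈ Set.Icc (0 : ℝ) 1) {a : Fin K} {d : ℝ} (hd : 0 < d)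
    (hgap : ∀ b, b ≠ a → d ≤ μ a - μ b) {lo up w : Fin K → ℝ} (hlo : ∀ b, lo b ≤ μ b)
    (hup : ∀ b, μ b ≤ up b) (hlt : lo a < up a) (h : IsExplorationBiasedWeights lo up w)
    (b : Fin K) : d ^ 2 / (2 * K) ≤ w b := by
  have hK0 : (0 : ℝ) < K := by positivity
  have : Nontrivial (Fin K) := Fin.nontrivial_iff_two_le.2 hK
  obtain ⟨b₀, hb₀⟩ := exists_ne a
  have hd1 : d ≤ 1 := by linarith [hgap b₀ hb₀, (hμ01 a).2, (hμ01 b₀).1]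
  rcases h with ⟨-, rfl⟩ | ⟨hne, a', ha', hmax, rfl⟩
  · rw [div_le_div_iff₀ (by positivity) hK0]
    have hd2 : d ^ 2 ≤ 1 := pow_le_one₀ hd.le hd1
    nlinarith
  · have hpot : a ∈ potentialBest lo up := by
      obtain ⟨c, hc⟩ := exists_eq_ciSup_of_finite (f := lo)
      change (⨆ c, lo c) < up a
      rw [← hc]
      by_cases hca : c = a
      · rwa [hca]
      · linarith [hlo c, hup a, hgap c hca]
    have hbest := isUniqueBest_testBandit hpot hne
    obtain ⟨c, hc⟩ := exists_eq_ciInf_of_finite (f := up)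
    -- In the test bandit of the true best arm, all gaps lie between `d (up a - m)` and `up a - m`.
    -- The lower bound uses `m ≥ 0` and `μ a ≤ 1`. The selected test bandit has at least as large a
    -- minimal weight.
    set m := ⨅ c, up c
    have hm0 : 0 ≤ m := by rw [← hc]; exact (hμ01 c).1.trans (hup c)
    have hma : m < up a := hne.trans hpot
    have ha0 : testBandit lo up a a = up a := by simp [testBandit]
    have hb1 : ∀ b, b ≠ a → testBandit lo up a b = max (lo b) m := fun b hb => by
      simp [testBandit, hb, m]
    have hlow : ∀ c, d ^ 2 / (2 * K) ≤ optWeights Set.univ (testBandit lo up a) c := by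
      refine le_optWeights hK hbest (D := up a - m) hd.le (by linarith) (fun b hb => ?_)
        (fun b hb => ?_)
      · rw [ha0, hb1 b hb, le_sub_comm]
        refine max_le ?_ ?_
        · have h1 := hup a
          have h2 := hlo b
          have h3 := hgap b hb
          have h4 := (hμ01 a).2
          nlinarith
        · nlinarith
      · rw [ha0, hb1 b hb]
        linarith [le_max_right (lo b) m]
    have h1 : d ^ 2 / (2 * K) ≤ minWeight (optWeights Set.univ (testBandit lo up a)) :=
      le_ciInf hlow
    have h2 : minWeight (optWeights Set.univ (testBandit lo up a')) ≤
        optWeights Set.univ (testBandit lo up a') b :=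
      ciInf_le (Set.finite_range _).bddBelow b
    exact h1.trans ((hmax a hpot).trans h2)

/-- Exploration-biased weights of a small region around `μ` are nearly optimal for `μ`. -/
theorem IsExplorationBiasedWeights.nearly_optimal {K : ℕ} {μ : Fin K → ℝ}
    (hμ01 : ∀ c, μ c ∈ Set.Icc (0 : ℝ) 1) {a : Fin K} (hμ : IsUniqueBest μ a) {ρ : ℝ}
    (hρ1 : 2 * ρ ≤ 1)
    (hgap : ∀ b, b ≠ a → 2 * ρ < μ a - μ b) {lo up w : Fin K → ℝ} (hlo : ∀ b, |lo b - μ b| ≤ ρ)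
    (hup : ∀ b, |up b - μ b| ≤ ρ) (h : IsExplorationBiasedWeights lo up w)
    {v : Fin K → ℝ} (hv : v ∈ stdSimplex ℝ (Fin K)) {b : Fin K} (hb : b ≠ a) :
    altCost (Set.Icc 0 1) μ v - 6 * ρ ≤ harm (w a) (w b) * (μ a - μ b) ^ 2 / 2 := by
  have hlo' := fun b => abs_le.1 (hlo b)
  have hup' := fun b => abs_le.1 (hup b)
  have hsup : lo a ≤ ⨆ c, lo c := le_ciSup (Set.finite_range _).bddAbove a
  have hinf : ∀ b, (⨅ c, up c) ≤ up b := fun b => ciInf_le (Set.finite_range _).bddBelow b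
  rcases h with ⟨hle, -⟩ | ⟨hlt, a', ha', -, rfl⟩
  · linarith [hinf b, hup' b, hlo' a, hgap b hb]
  -- The intervals are too short for any arm but `a` to be potentially best.
  · have haa : a' = a := by
      by_contra hne
      have h1 : (⨆ c, lo c) < up a' := ha'
      linarith [hup' a', hlo' a, hgap a' hne]
    subst haa
    have hclose : ∀ c, c ≠ a' → |(testBandit lo up a' a' - testBandit lo up a' c) -
        (μ a' - μ c)| ≤ 2 * ρ := fun c hc => by
      simp only [testBandit, hc, if_true, if_false]
      have h1 := hlo' c
      have h2 := hup' c
      have h3 := hup' a'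
      have h4 := hinf c
      have h5 := le_max_left (lo c) (⨅ c, up c)
      have h6 : max (lo c) (⨅ c, up c) ≤ μ c + ρ := max_le (by linarith) (by linarith)
      rw [abs_le]
      constructor <;> linarith
    have := optWeights_nearly_optimal hμ01 hμ (isUniqueBest_testBandit ha' hlt) hb hρ1 hclose hv
    linarith

/-! ### Draws and tracking -/

section Tracking

variable {K : ℕ} {Ω : Type*} {A : ℕ → Ω → Fin K} {Y : ℕ → Ω → ℝ} {w : ℕ → Ω → Fin K → ℝ} {γ : ℝ}

theorem draws_succ (A : ℕ → Ω → Fin K) (t : ℕ) (ω : Ω) (a : Fin K) :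
    draws A (t + 1) ω a = draws A t ω a + if A (t + 1) ω = a then 1 else 0 := by
  unfold draws
  rw [← Finset.insert_Icc_right_eq_Icc_add_one (by omega), Finset.filter_insert]
  split_ifs
  · rw [Finset.card_insert_of_notMem (by simp)]
  · rfl

theorem draws_mono (A : ℕ → Ω → Fin K) (ω : Ω) (a : Fin K) : Monotone fun t => draws A t ω a :=
  monotone_nat_of_le_succ fun t => by rw [draws_succ]; omega

theorem draws_le (A : ℕ → Ω → Fin K) (t : ℕ) (ω : Ω) (a : Fin K) : draws A t ω a ≤ t :=
  (Finset.card_filter_le _ _).trans (by simp)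

theorem sum_draws (A : ℕ → Ω → Fin K) (t : ℕ) (ω : Ω) : ∑ a, draws A t ω a = t := by
  unfold draws
  rw [← Finset.card_eq_sum_card_fiberwise (fun _ _ => Finset.mem_coe.2 (Finset.mem_univ _))]
  simp

theorem IsExplorationBiasedSampling.one_le_draws (h : IsExplorationBiasedSampling γ A Y w) {t : ℕ}
    (ht : K ≤ t) (ω : Ω) (a : Fin K) : 1 ≤ draws A t ω a :=
  (h.init_draws ω a).ge.trans (draws_mono A ω a ht)

theorem IsExplorationBiasedSampling.weights_mem_stdSimplex
    (h : IsExplorationBiasedSampling γ A Y w) (hK : 2 ≤ K) (t : ℕ) (ω : Ω) :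
    w t ω ∈ stdSimplex ℝ (Fin K) := by
  rcases lt_or_ge t K with ht | ht
  · rw [h.init_weights t ht ω]
    exact uniform_mem_stdSimplex hK
  · exact (h.weights t ht ω).mem_stdSimplex hK

/-- The excesses of draws over cumulated weights sum to zero, so the arm minimizing the excess has a
nonpositive one just before it is drawn; the draw raises it by at most `1`. -/
theorem IsExplorationBiasedSampling.draws_le_sum_weights_add_one
    (h : IsExplorationBiasedSampling γ A Y w) (hK : 2 ≤ K) {t : ℕ} (ht : K ≤ t) (ω : Ω)
    (a : Fin K) : (draws A t ω a : ℝ) ≤ ∑ s ∈ Finset.Icc 1 t, w s ω a + 1 := by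
  induction t, ht using Nat.le_induction with
  | base =>
    rw [h.init_draws]
    have : 0 ≤ ∑ s ∈ Finset.Icc 1 K, w s ω a :=
      Finset.sum_nonneg fun s _ => (h.weights_mem_stdSimplex hK s ω).1 a
    push_cast
    linarith
  | succ t ht ih =>
    have hw := (h.weights_mem_stdSimplex hK (t + 1) ω).1 a
    rw [draws_succ, Finset.sum_Icc_succ_top (by omega)]
    split_ifs with hA
    · have htr := h.tracking t ht ω
      rw [hA] at htr
      have hsum : ∑ b, ((draws A t ω b : ℝ) - ∑ s ∈ Finset.Icc 1 t, w s ω b) = 0 := by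
        rw [Finset.sum_sub_distrib, Finset.sum_comm, ← Nat.cast_sum, sum_draws,
          Finset.sum_congr rfl fun s _ => (h.weights_mem_stdSimplex hK s ω).2]
        simp
      have h1 := Finset.card_nsmul_le_sum Finset.univ _ _ fun b _ => htr b
      rw [hsum, nsmul_eq_mul] at h1
      have hK0 : (0 : ℝ) < (Finset.univ : Finset (Fin K)).card := by
        simp; omega
      have h2 := nonpos_of_mul_nonpos_right h1 hK0
      push_cast
      linarith
    · push_cast
      linarith

/-- The numbers of draws follow the cumulated weights up to a constant. -/
theorem IsExplorationBiasedSampling.sum_weights_le_draws_add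
    (h : IsExplorationBiasedSampling γ A Y w) (hK : 2 ≤ K) {t : ℕ} (ht : K ≤ t) (ω : Ω)
    (a : Fin K) : ∑ s ∈ Finset.Icc 1 t, w s ω a ≤ draws A t ω a + K := by
  -- The slacks in the upper bound are nonnegative and sum to `K`, so each is at most `K`.
  have hsum : ∑ b, (∑ s ∈ Finset.Icc 1 t, w s ω b + 1 - (draws A t ω b : ℝ)) = K := by
    rw [Finset.sum_sub_distrib, Finset.sum_add_distrib, Finset.sum_comm, ← Nat.cast_sum, sum_draws,
      Finset.sum_congr rfl fun s _ => (h.weights_mem_stdSimplex hK s ω).2]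
    simp
  have h1 := Finset.single_le_sum (f := fun b => ∑ s ∈ Finset.Icc 1 t, w s ω b + 1 -
    (draws A t ω b : ℝ)) (fun b _ => sub_nonneg.2
    (h.draws_le_sum_weights_add_one hK ht ω b)) (Finset.mem_univ a)
  rw [hsum] at h1
  linarith

end Tracking

/-! ### Widths of the confidence intervals -/

theorem tendsto_confWidth {γ : ℝ} (hγ : 0 < γ) :
    Filter.Tendsto (fun n : ℕ => confWidth γ n) Filter.atTop (nhds 0) := by
  have h4 : (0 : ℝ) < 4 / γ := by positivity
  have h1 : Filter.Tendsto (fun x : ℝ => Real.log x / x) Filter.atTop (nhds 0) :=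
    Real.isLittleO_log_id_atTop.tendsto_div_nhds_zero
  have h2 : Filter.Tendsto (fun n : ℕ => 4 / γ * (n : ℝ)) Filter.atTop Filter.atTop :=
    tendsto_natCast_atTop_atTop.const_mul_atTop h4
  have h3 := ((((h1.comp h2).const_mul (4 / γ)).sqrt).const_mul 2)
  simp only [mul_zero, Real.sqrt_zero] at h3
  refine h3.congr fun n => ?_
  unfold confWidth
  congr 2
  rcases eq_or_ne (n : ℝ) 0 with hn | hn
  · simp [hn]
  · simp only [Function.comp]
    rw [show 4 * (n : ℝ) / γ = 4 / γ * n by ring]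
    field_simp

theorem confWidth_pos {γ s : ℝ} (hγ : 0 < γ) (hγ1 : γ ≤ 1) (hs : 1 ≤ s) : 0 < confWidth γ s := by
  unfold confWidth
  have : 0 < Real.log (4 * s / γ) := Real.log_pos (by rw [lt_div_iff₀ hγ]; linarith)
  positivity

/-! ### The confidence event -/

/-- All the confidence intervals contain the means. -/
def confEvent {K : ℕ} {Ω : Type*} (γ : ℝ) (μ : Fin K → ℝ) (A : ℕ → Ω → Fin K)
    (Y : ℕ → Ω → ℝ) : Set Ω :=
  {ω | ∀ t a, 1 ≤ draws A t ω a →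
    |empMean A Y t ω a - μ a| ≤ confWidth (γ / K) (draws A t ω a)}

/-- On the confidence event, all the intervals are short after a deterministic time. -/
theorem exists_confWidth_le {K : ℕ} (hK : 2 ≤ K) {γ : ℝ} (hγ : γ ∈ Set.Ioo (0 : ℝ) 1)
    {μ : Fin K → ℝ} (hμ01 : ∀ c, μ c ∈ Set.Icc (0 : ℝ) 1) {a : Fin K} {d : ℝ} (hd : 0 < d)
    (hgap : ∀ b, b ≠ a → d ≤ μ a - μ b) {ρ : ℝ} (hρ : 0 < ρ) :
    ∃ t₁ : ℕ, K ≤ t₁ ∧ ∀ t, t₁ ≤ t → ∀ {Ω : Type*} {A : ℕ → Ω → Fin K} {Y : ℕ → Ω → ℝ}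
      {w : ℕ → Ω → Fin K → ℝ}, IsExplorationBiasedSampling γ A Y w →
      ∀ ω ∈ confEvent γ μ A Y, ∀ b, confWidth (γ / K) (draws A t ω b) ≤ ρ := by
  have hK0 : (0 : ℝ) < K := by positivity
  have hγK : 0 < γ / K := div_pos hγ.1 hK0
  have hγK1 : γ / K ≤ 1 := by
    rw [div_le_one hK0]
    have : (2 : ℝ) ≤ K := by exact_mod_cast hK
    linarith [hγ.2]
  obtain ⟨n₀, hn₀⟩ := Filter.eventually_atTop.1
    ((tendsto_confWidth hγK).eventually (ge_mem_nhds hρ))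
  set c := d ^ 2 / (2 * K) with hc
  have hc0 : 0 < c := by positivity
  -- With all weights at least `c`, arm `b` has at least `c t - K ≥ n₀` draws. The time is fixed
  -- before the process, as `δ₀` must be.
  obtain ⟨t₁, ht₁⟩ := exists_nat_ge ((n₀ + 2 * K) / c)
  refine ⟨max K t₁, le_max_left _ _, fun t ht Ω A Y w h ω hω b => hn₀ _ ?_⟩
  have htK : K ≤ t := (le_max_left _ _).trans ht
  have htt : (t₁ : ℝ) ≤ t := by exact_mod_cast (le_max_right _ _).trans ht
  have hw : ∀ s ∈ Finset.Icc 1 t, c ≤ w s ω b := by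
    intro s _
    rcases lt_or_ge s K with hs | hs
    · have hd1 : d ≤ 1 := by
        have : Nontrivial (Fin K) := Fin.nontrivial_iff_two_le.2 hK
        obtain ⟨b₀, hb₀⟩ := exists_ne a
        linarith [hgap b₀ hb₀, (hμ01 a).2, (hμ01 b₀).1]
      rw [h.init_weights s hs ω, hc, div_le_div_iff₀ (by positivity) hK0]
      have hd2 : d ^ 2 ≤ 1 := pow_le_one₀ hd.le hd1
      nlinarith
    · have hconf := fun b => abs_le.1 (hω s b (h.one_le_draws hs ω b))
      have hpos : 0 < confWidth (γ / K) (draws A s ω a) :=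
        confWidth_pos hγK hγK1 (by exact_mod_cast h.one_le_draws hs ω a)
      refine (h.weights s hs ω).le hK hμ01 hd hgap (fun b => ?_) (fun b => ?_) ?_ b
      · unfold lowerConf; linarith [hconf b]
      · unfold upperConf; linarith [hconf b]
      · unfold lowerConf upperConf; linarith
  have h1 := Finset.card_nsmul_le_sum _ _ _ hw
  have h2 := h.sum_weights_le_draws_add hK htK ω b
  rw [div_le_iff₀ hc0] at ht₁
  simp only [Nat.card_Icc, nsmul_eq_mul, Nat.add_sub_cancel] at h1
  have h3 : (n₀ : ℝ) ≤ draws A t ω b := by nlinarith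
  exact_mod_cast h3

/-- On the confidence event, the statistic grows at the optimal rate. -/
theorem exists_le_glr {K : ℕ} (hK : 2 ≤ K) {γ : ℝ} (hγ : γ ∈ Set.Ioo (0 : ℝ) 1)
    {μ : Fin K → ℝ} (hμ01 : ∀ c, μ c ∈ Set.Icc (0 : ℝ) 1) {a : Fin K} (hμ : IsUniqueBest μ a)
    {v : Fin K → ℝ} (hv : v ∈ stdSimplex ℝ (Fin K)) (hv0 : 0 ≤ altCost (Set.Icc 0 1) μ v)
    {ε : ℝ} (hε : 0 < ε) :
    ∃ t₀ : ℕ, K ≤ t₀ ∧ ∀ t, t₀ ≤ t → ∀ {Ω : Type*} {A : ℕ → Ω → Fin K} {Y : ℕ → Ω → ℝ}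
      {w : ℕ → Ω → Fin K → ℝ}, IsExplorationBiasedSampling γ A Y w →
      ∀ ω ∈ confEvent γ μ A Y, t * (altCost (Set.Icc 0 1) μ v - ε) ≤ glr A Y t ω := by
  have hK0 : (0 : ℝ) < K := by positivity
  have : Nontrivial (Fin K) := Fin.nontrivial_iff_two_le.2 hK
  obtain ⟨b₀, hb₀⟩ := exists_ne a
  have hnt : Nonempty {b // b ≠ a} := ⟨⟨b₀, hb₀⟩⟩
  obtain ⟨d, hd, hgap⟩ : ∃ d > 0, ∀ b, b ≠ a → d ≤ μ a - μ b := by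
    obtain ⟨b, hb⟩ := Finite.exists_min fun b : {b // b ≠ a} => μ a - μ b
    exact ⟨_, sub_pos.2 (hμ b b.2), fun c hc => hb ⟨c, hc⟩⟩
  have hd1 : d ≤ 1 := by linarith [hgap b₀ hb₀, (hμ01 a).2, (hμ01 b₀).1]
  set V := altCost (Set.Icc 0 1) μ v
  -- Intervals are within `2ρ` of the means, which costs `12ρ` in the weights; the empirical gaps
  -- cost `3ρ` more. These `15ρ` use half of `ε`; the other half pays for the first `t₁` rounds and
  -- the tracking error `K`.
  obtain ⟨ρ, hρ, hρd, hρε⟩ : ∃ ρ > 0, 8 * ρ ≤ d ∧ 30 * ρ ≤ ε :=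
    ⟨min (d / 8) (ε / 30), by positivity, by linarith [min_le_left (d / 8) (ε / 30)],
      by linarith [min_le_right (d / 8) (ε / 30)]⟩
  obtain ⟨t₁, hKt₁, ht₁⟩ := exists_confWidth_le hK hγ hμ01 hd hgap hρ
  obtain ⟨t₂, ht₂⟩ := exists_nat_ge ((t₁ * V + K) / (ε / 2))
  rw [div_le_iff₀ (by positivity)] at ht₂
  refine ⟨max t₁ t₂, hKt₁.trans (le_max_left _ _), fun t ht Ω A Y w h ω hω => ?_⟩
  have ht1 : t₁ ≤ t := (le_max_left _ _).trans ht
  have ht2 : (t₂ : ℝ) ≤ t := by exact_mod_cast (le_max_right _ _).trans ht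
  have ht1' : (t₁ : ℝ) ≤ t := by exact_mod_cast ht1
  have hmean : ∀ s, t₁ ≤ s → ∀ b, |empMean A Y s ω b - μ b| ≤ ρ := fun s hs b =>
    (hω s b (h.one_le_draws (hKt₁.trans hs) ω b)).trans (ht₁ s hs h ω hω b)
  have hsimp := fun s => h.weights_mem_stdSimplex hK s ω
  refine le_trans (le_ciInf ?_) (le_ciSup (f := fun a : Fin K =>
    ⨅ b : {b : Fin K // b ≠ a}, glrPair A Y t ω a b) (Set.finite_range _).bddAbove a)
  rintro ⟨b, hb⟩
  have hsq0 : 0 ≤ (μ a - μ b) ^ 2 := sq_nonneg _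
  have hsq1 : (μ a - μ b) ^ 2 ≤ 1 :=
    pow_le_one₀ (sub_nonneg.2 (hμ b hb).le) (by linarith [(hμ01 a).2, (hμ01 b).1])
  set Na := (draws A t ω a : ℝ)
  set Nb := (draws A t ω b : ℝ)
  have hNa : 0 ≤ Na := Nat.cast_nonneg _
  have hNb : 0 ≤ Nb := Nat.cast_nonneg _
  have hNat : Na ≤ t := Nat.cast_le.2 (draws_le A t ω a)
  have hweights : ∀ s ∈ Finset.Icc t₁ t,
      V - 12 * ρ ≤ harm (w s ω a) (w s ω b) * ((μ a - μ b) ^ 2 / 2) := by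
    intro s hs
    obtain ⟨hs1, -⟩ := Finset.mem_Icc.1 hs
    have hm := fun b => abs_le.1 (hmean s hs1 b)
    have hcw := fun b => ht₁ s hs1 h ω hω b
    have hcw0 : ∀ b, 0 ≤ confWidth (γ / K) (draws A s ω b) := fun b => by
      unfold confWidth; positivity
    have := (h.weights s (hKt₁.trans hs1) ω).nearly_optimal hμ01 hμ (ρ := 2 * ρ) (by linarith)
      (fun b hb => by linarith [hgap b hb])
      (fun b => by
        rw [abs_le]; unfold lowerConf
        constructor <;> linarith [hm b, hcw b, hcw0 b])
      (fun b => by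
        rw [abs_le]; unfold upperConf
        constructor <;> linarith [hm b, hcw b, hcw0 b]) hv hb
    linarith
  have h1 := Finset.card_nsmul_le_sum _ _ _ hweights
  rw [← Finset.sum_mul, Nat.card_Icc, nsmul_eq_mul, Nat.cast_sub (by omega)] at h1
  have hsub : Finset.Icc t₁ t ⊆ Finset.Icc 1 t := Finset.Icc_subset_Icc_left (by omega)
  -- Superadditivity passes from the rounds to the cumulated weights, and tracking from these to the
  -- counts.
  have h2 : ∑ s ∈ Finset.Icc t₁ t, harm (w s ω a) (w s ω b) ≤ harm Na Nb + K := by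
    refine (sum_harm_le _ (fun s _ => (hsimp s).1 a) fun s _ => (hsimp s).1 b).trans ?_
    refine le_trans (harm_mono (Finset.sum_nonneg fun s _ => (hsimp s).1 a)
      (Finset.sum_nonneg fun s _ => (hsimp s).1 b) ?_ ?_) (harm_add_le hNa hNb hK0.le)
    · exact (Finset.sum_le_sum_of_subset_of_nonneg hsub fun s _ _ => (hsimp s).1 a).trans
        (h.sum_weights_le_draws_add hK (hKt₁.trans ht1) ω a)
    · exact (Finset.sum_le_sum_of_subset_of_nonneg hsub fun s _ _ => (hsimp s).1 b).trans
        (h.sum_weights_le_draws_add hK (hKt₁.trans ht1) ω b)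
  have hma := abs_le.1 (hmean t ht1 a)
  have hmb := abs_le.1 (hmean t ht1 b)
  have hx := sq_sub_sq_le (x := empMean A Y t ω a - empMean A Y t ω b) (y := μ a - μ b)
    (κ := 2 * ρ) (sub_nonneg.2 (hμ b hb).le) (by linarith [(hμ01 a).2, (hμ01 b).1])
    (by linarith) (by rw [abs_le]; constructor <;> linarith)
  have hxpos : 0 ≤ empMean A Y t ω a - empMean A Y t ω b := by linarith [hgap b hb]
  have hglr : glrPair A Y t ω a b =
      harm Na Nb * (empMean A Y t ω a - empMean A Y t ω b) ^ 2 / 2 := by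
    unfold glrPair harm
    rw [abs_of_nonneg hxpos]
    ring
  change _ ≤ glrPair A Y t ω a b
  rw [hglr]
  have hh0 := harm_nonneg hNa hNb
  have hht : harm Na Nb ≤ t := (harm_le_left hNa hNb).trans hNat
  have h3 := mul_le_mul_of_nonneg_left (abs_le.1 hx).1 hh0
  have h4 := mul_le_mul_of_nonneg_right h2 (by positivity : 0 ≤ (μ a - μ b) ^ 2 / 2)
  have h5 : harm Na Nb * (3 * ρ) ≤ t * (3 * ρ) := by gcongr
  have h6 : (K : ℝ) * ((μ a - μ b) ^ 2 / 2) ≤ K := by nlinarith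
  have h7 : (t - t₁ : ℝ) * (V - 12 * ρ) + (V - 12 * ρ) ≤ harm Na Nb * ((μ a - μ b) ^ 2 / 2) + K := by
    push_cast at h1
    nlinarith
  have h8 : 0 ≤ (t₁ : ℝ) * ρ := by positivity
  have h9 : (t : ℝ) * (30 * ρ) ≤ t * ε := by gcongr
  have h10 : (1 : ℝ) ≤ t₁ := by exact_mod_cast (by omega : 1 ≤ t₁)
  nlinarith

/-- For small risks the threshold is passed after time `(1 + η / 2) T log (1 / δ)`. -/
theorem exists_threshold_lt {T η α R : ℝ} (hT : 0 < T) (hη : η ∈ Set.Ioc (0 : ℝ) 1) (hR : 0 < R)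
    (t₀ : ℕ) :
    ∃ L₀ : ℝ, 0 < L₀ ∧ ∀ δ : ℝ, 0 < δ → L₀ ≤ Real.log (1 / δ) → ∀ t : ℕ,
      (1 + η / 2) * T * Real.log (1 / δ) < t →
      t₀ ≤ t ∧ threshold R α t δ < t * (T⁻¹ - η / 8 * T⁻¹) := by
  obtain ⟨hη0, hη1⟩ := hη
  have hlim : Filter.Tendsto (fun x : ℝ => (Real.log R + α * Real.log x) / x) Filter.atTop
      (nhds 0) := by
    have h1 : Filter.Tendsto (fun x : ℝ => Real.log x / x) Filter.atTop (nhds 0) :=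
      Real.isLittleO_log_id_atTop.tendsto_div_nhds_zero
    have h2 := (tendsto_inv_atTop_zero.const_mul (Real.log R)).add (h1.const_mul α)
    simp only [mul_zero, add_zero] at h2
    exact h2.congr fun x => by ring
  obtain ⟨x₀, hx₀⟩ := Filter.eventually_atTop.1
    (hlim.eventually (ge_mem_nhds (by positivity : 0 < η / 16 * T⁻¹)))
  refine ⟨(max x₀ 0 + t₀ + 1) / T, by positivity, fun δ hδ hL t ht => ?_⟩
  rw [div_le_iff₀ hT] at hL
  set L := Real.log (1 / δ) with hLdef
  have hx0 : 0 ≤ max x₀ 0 := le_max_right _ _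
  have ht0' : (0 : ℝ) ≤ t₀ := Nat.cast_nonneg _
  have hLT : 0 < L * T := by linarith
  have htL : L * T < t := by nlinarith
  have ht0 : (0 : ℝ) < t := by linarith
  refine ⟨?_, ?_⟩
  · have : (t₀ : ℝ) ≤ t := by linarith
    exact_mod_cast this
  · have h1 := hx₀ t (by linarith [le_max_left x₀ 0])
    rw [div_le_iff₀ ht0] at h1
    have h2 : threshold R α t δ = Real.log R + α * Real.log t + L := by
      unfold threshold
      rw [hLdef, mul_div_assoc, Real.log_mul hR.ne' (by positivity), Real.log_div (by positivity)
        hδ.ne', Real.log_rpow ht0, Real.log_div one_ne_zero hδ.ne', Real.log_one]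
      ring
    rw [h2]
    -- This is `(1 + η/2)(1 - η/4) ≥ 1`. The remaining logarithms take `η/16`, and `η/4 - η/16 >
    -- η/8`.
    have h3 : L ≤ t * T⁻¹ * (1 - η / 4) := by
      rw [← div_eq_mul_inv, div_mul_eq_mul_div, le_div_iff₀ hT]
      nlinarith [mul_nonneg hLT.le hη0.le, mul_nonneg (mul_nonneg hLT.le hη0.le) (sub_nonneg.2 hη1)]
    have h4 : 0 < t * T⁻¹ * η := by positivity
    nlinarith

/-! ### Probability of the confidence event -/

/-- The factor contributed by a Gaussian noise `ξ` to the exponential martingale of the sum of the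
noises selected by `J`. -/
noncomputable def expFactor {Ω : Type*} (J : Set Ω) (ξ : Ω → ℝ) (c : ℝ) (ω : Ω) : ENNReal :=
  J.indicator (fun ω => ENNReal.ofReal (Real.exp (c * ξ ω - c ^ 2 / 2))) ω + Jᶜ.indicator 1 ω

theorem measurable_mul_expFactor {Ω : Type*} {m : MeasurableSpace Ω} {M : Ω → ENNReal} {J : Set Ω}
    {ξ : Ω → ℝ} (hM : Measurable M) (hJ : MeasurableSet J) (hξ : Measurable ξ) (c : ℝ) :
    Measurable fun ω => M ω * expFactor J ξ c ω :=
  hM.mul ((Measurable.indicator (by fun_prop) hJ).add (measurable_one.indicator hJ.compl))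

/-! ### Exponential martingale of selected Gaussian noises -/

section Concentration

variable {Ω : Type*} [mΩ : MeasurableSpace Ω] {P : Measure Ω}

theorem lintegral_exp_gaussian {ξ : Ω → ℝ} (h : HasLaw ξ (gaussianReal 0 1) P) (c : ℝ) :
    ∫⁻ ω, ENNReal.ofReal (Real.exp (c * ξ ω - c ^ 2 / 2)) ∂P = 1 := by
  have h1 : mgf ξ P c = Real.exp (c ^ 2 / 2) := by
    rw [mgf_gaussianReal h.map_eq]
    simp
  have hint : Integrable (fun ω => Real.exp (c * ξ ω)) P := by
    -- A non-integrable exponential would give `mgf` its default value `0`.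
    by_contra hni
    have := mgf_undef (X := ξ) (μ := P) (t := c) hni
    rw [h1] at this
    exact (Real.exp_pos _).ne' this
  have h2 : ∀ ω, Real.exp (c * ξ ω - c ^ 2 / 2) = Real.exp (c * ξ ω) * Real.exp (-(c ^ 2 / 2)) :=
    fun ω => by rw [← Real.exp_add, sub_eq_add_neg]
  simp only [h2]
  rw [← ofReal_integral_eq_lintegral_ofReal (hint.mul_const _)
    (Filter.Eventually.of_forall fun ω => by positivity), integral_mul_const]
  change ENNReal.ofReal (mgf ξ P c * _) = 1
  rw [h1, ← Real.exp_add]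
  simp

/-- The exponential martingale of a sum of predictably selected Gaussian noises. -/
theorem lintegral_prod_expFactor [IsProbabilityMeasure P] {ℱ : Filtration ℕ mΩ} {ξ : ℕ → Ω → ℝ}
    (hξ : ∀ n, Measurable[ℱ (n + 1)] (ξ n)) (hlaw : ∀ n, HasLaw (ξ n) (gaussianReal 0 1) P)
    (hind : ∀ n, Indep (MeasurableSpace.comap (ξ n) inferInstance) (ℱ n) P)
    {J : ℕ → Set Ω} (hJ : ∀ n, MeasurableSet[ℱ n] (J n)) (c : ℝ) (n : ℕ) :
    Measurable[ℱ n] (fun ω => ∏ u ∈ Finset.range n, expFactor (J u) (ξ u) c ω) ∧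
      ∫⁻ ω, ∏ u ∈ Finset.range n, expFactor (J u) (ξ u) c ω ∂P = 1 := by
  have he : Measurable fun x : ℝ => ENNReal.ofReal (Real.exp (c * x - c ^ 2 / 2)) := by fun_prop
  induction n with
  | zero => simp
  | succ n ih =>
    obtain ⟨hM, hI⟩ := ih
    set M := fun ω => ∏ u ∈ Finset.range n, expFactor (J u) (ξ u) c ω with hMdef
    have hJ' : MeasurableSet[ℱ (n + 1)] (J n) := ℱ.mono (Nat.le_succ n) _ (hJ n)
    have hM' : Measurable[ℱ (n + 1)] M := hM.mono (ℱ.mono (Nat.le_succ n)) le_rfl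
    simp only [Finset.prod_range_succ]
    refine ⟨?_, ?_⟩
    · exact measurable_mul_expFactor hM' hJ' (hξ n) c
    -- Where `J n` selects the noise, the new factor is independent of the past and has mean `1`;
    -- elsewhere the product is unchanged.
    · have hsplit : ∀ ω, M ω * expFactor (J n) (ξ n) c ω =
          (J n).indicator M ω * ENNReal.ofReal (Real.exp (c * ξ n ω - c ^ 2 / 2)) +
            (J n)ᶜ.indicator M ω := by
        intro ω
        unfold expFactor
        by_cases h : ω ∈ J n <;> simp [h]
      have hMm : Measurable M := hM.mono (ℱ.le n) le_rfl
      have hξm : Measurable (ξ n) := (hξ n).mono (ℱ.le _) le_rfl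
      have hJm : MeasurableSet (J n) := ℱ.le n _ (hJ n)
      change ∫⁻ ω, M ω * expFactor (J n) (ξ n) c ω ∂P = 1
      simp only [hsplit]
      rw [lintegral_add_right _ (hMm.indicator hJm.compl)]
      have hprod := lintegral_mul_eq_lintegral_mul_lintegral_of_independent_measurableSpace
        (ℱ.le n) hξm.comap_le (hind n).symm (f := (J n).indicator M)
        (g := fun ω => ENNReal.ofReal (Real.exp (c * ξ n ω - c ^ 2 / 2)))
        (hM.indicator (hJ n)) (he.comp (comap_measurable (ξ n)))
      rw [hprod, lintegral_exp_gaussian (hlaw n), mul_one,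
        ← lintegral_add_right _ (hMm.indicator hJm.compl), ← hI]
      refine lintegral_congr fun ω => ?_
      by_cases h : ω ∈ J n <;> simp [h, hMdef]

end Concentration

/-! ### Deviations of the sums of noises -/

section NoiseSum

variable {K : ℕ} {Ω : Type*}

/-- The sum of the noises of the rewards of arm `a`, whose mean is `m`, up to time `t`. -/
noncomputable def noiseSum (A : ℕ → Ω → Fin K) (Y : ℕ → Ω → ℝ) (m : ℝ) (t : ℕ) (ω : Ω)
    (a : Fin K) : ℝ :=
  ∑ s ∈ (Finset.Icc 1 t).filter (fun s => A s ω = a), (Y s ω - m)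

theorem noiseSum_succ (A : ℕ → Ω → Fin K) (Y : ℕ → Ω → ℝ) (m : ℝ) (t : ℕ) (ω : Ω) (a : Fin K) :
    noiseSum A Y m (t + 1) ω a =
      noiseSum A Y m t ω a + if A (t + 1) ω = a then Y (t + 1) ω - m else 0 := by
  unfold noiseSum
  rw [← Finset.insert_Icc_right_eq_Icc_add_one (by omega), Finset.filter_insert]
  split_ifs
  · rw [Finset.sum_insert (by simp), add_comm]
  · rw [add_zero]

theorem noiseSum_eq (A : ℕ → Ω → Fin K) (Y : ℕ → Ω → ℝ) (m : ℝ) {t : ℕ} {ω : Ω} {a : Fin K}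
    (h : 1 ≤ draws A t ω a) :
    noiseSum A Y m t ω a = draws A t ω a * (empMean A Y t ω a - m) := by
  have h0 : (draws A t ω a : ℝ) ≠ 0 := by positivity
  unfold noiseSum empMean
  rw [Finset.sum_sub_distrib, mul_sub, mul_div_cancel₀ _ h0, Finset.sum_const, nsmul_eq_mul]
  rfl

variable [mΩ : MeasurableSpace Ω] {P : Measure Ω} {μ : Fin K → ℝ}
  {ℱ : Filtration ℕ mΩ} {A : ℕ → Ω → Fin K} {Y : ℕ → Ω → ℝ}

theorem IsBanditSampling.measurable_draws (h : IsBanditSampling P μ ℱ A Y) (a : Fin K) (t : ℕ) :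
    Measurable[ℱ t] fun ω => draws A t ω a := by
  induction t with
  | zero => simp [draws]
  | succ t ih =>
    simp only [draws_succ]
    refine (ih.mono (ℱ.mono (Nat.le_succ t)) le_rfl).add (Measurable.ite ?_ measurable_const
      measurable_const)
    exact ℱ.mono (Nat.le_succ t) _ (h.measurable_arm t (measurableSet_singleton a))

/-- Deviation of the sum of the first `s` noises of arm `a`. -/
theorem IsBanditSampling.measure_noiseSum_le [IsProbabilityMeasure P]
    (h : IsBanditSampling P μ ℱ A Y) (a : Fin K) (s : ℕ)
    (c y : ℝ) :
    P {ω | ∃ t, draws A t ω a = s ∧ y ≤ c * noiseSum A Y (μ a) t ω a - s * (c ^ 2 / 2)} ≤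
      ENNReal.ofReal (Real.exp (-y)) := by
  set ξ : ℕ → Ω → ℝ := fun u ω => Y (u + 1) ω - μ (A (u + 1) ω)
  -- Selection ends at the `s`-th draw of `a`, after which the martingale is frozen. One Markov
  -- inequality at time `n` thus covers all `t ≤ n` with `s` draws, without a union bound over time.
  set J : ℕ → Set Ω := fun u => {ω | A (u + 1) ω = a ∧ draws A u ω a < s}
  have hξ : ∀ n, Measurable[ℱ (n + 1)] (ξ n) := fun n =>
    (h.measurable_reward n).sub ((measurable_of_finite μ).comp
      ((h.measurable_arm n).mono (ℱ.mono (Nat.le_succ n)) le_rfl))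
  have hJ : ∀ n, MeasurableSet[ℱ n] (J n) := fun n =>
    MeasurableSet.inter (h.measurable_arm n (measurableSet_singleton a))
      (h.measurable_draws a n (measurableSet_Iio (a := s)))
  have hmart := lintegral_prod_expFactor hξ h.noise_law h.noise_indep hJ c
  set M : ℕ → Ω → ENNReal := fun n ω => ∏ u ∈ Finset.range n, expFactor (J u) (ξ u) c ω
  have hM : ∀ t ω, draws A t ω a ≤ s → M t ω = ENNReal.ofReal
      (Real.exp (c * noiseSum A Y (μ a) t ω a - draws A t ω a * (c ^ 2 / 2))) := by
    intro t ω
    induction t with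
    | zero => simp [M, draws, noiseSum]
    | succ t ih =>
      intro hs
      have hsucc : M (t + 1) ω = M t ω * expFactor (J t) (ξ t) c ω := Finset.prod_range_succ _ _
      rw [draws_succ] at hs
      rw [hsucc, ih (by omega), draws_succ, noiseSum_succ]
      by_cases hA : A (t + 1) ω = a
      · simp only [hA, if_true] at hs ⊢
        have hmem : ω ∈ J t := ⟨hA, by omega⟩
        simp only [expFactor, hmem, Set.indicator_of_mem, Set.mem_compl_iff, not_true, not_false_iff,
          Set.indicator_of_notMem, add_zero]
        rw [← ENNReal.ofReal_mul (Real.exp_nonneg _), ← Real.exp_add]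
        simp only [ξ, hA]
        push_cast
        ring_nf
      · have hmem : ω ∉ J t := fun h => hA h.1
        simp [expFactor, hmem, hA]
  have hbound : ∀ t ω, draws A t ω a = s → ∀ n, t ≤ n → M n ω = M t ω := by
    intro t ω hs n hn
    induction n, hn using Nat.le_induction with
    | base => rfl
    | succ n hn ih =>
      have hmem : ω ∉ J n := fun h => absurd h.2 (not_lt.2 (hs.ge.trans (draws_mono A ω a hn)))
      rw [← ih]
      change ∏ u ∈ Finset.range (n + 1), expFactor (J u) (ξ u) c ω = _
      rw [Finset.prod_range_succ]
      simp [M, expFactor, hmem]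
  set B : ℕ → Set Ω := fun n => {ω | ∃ t ≤ n, draws A t ω a = s ∧
    y ≤ c * noiseSum A Y (μ a) t ω a - s * (c ^ 2 / 2)}
  have hB : ∀ n, P (B n) ≤ ENNReal.ofReal (Real.exp (-y)) := by
    intro n
    have hsub : B n ⊆ {ω | ENNReal.ofReal (Real.exp y) ≤ M n ω} := by
      rintro ω ⟨t, ht, hs, hy⟩
      change _ ≤ M n ω
      rw [hbound t ω hs n ht, hM t ω hs.le, hs]
      exact ENNReal.ofReal_le_ofReal (Real.exp_le_exp.2 hy)
    have hmeas : Measurable (M n) := (hmart n).1.mono (ℱ.le n) le_rfl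
    have h1 := mul_meas_ge_le_lintegral hmeas (μ := P) (ENNReal.ofReal (Real.exp y))
    rw [(hmart n).2] at h1
    rw [Real.exp_neg, ENNReal.ofReal_inv_of_pos (Real.exp_pos _)]
    refine (measure_mono hsub).trans ?_
    rwa [ENNReal.le_inv_iff_mul_le, mul_comm]
  have hU : {ω | ∃ t, draws A t ω a = s ∧ y ≤ c * noiseSum A Y (μ a) t ω a - s * (c ^ 2 / 2)} =
      ⋃ n, B n := by
    ext ω
    simp only [Set.mem_iUnion, Set.mem_ofPred_eq, B]
    exact ⟨fun ⟨t, ht⟩ => ⟨t, t, le_rfl, ht⟩, fun ⟨_, t, _, ht⟩ => ⟨t, ht⟩⟩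
  have hmono : Monotone B := fun n m hnm ω ⟨t, ht, h⟩ => ⟨t, ht.trans hnm, h⟩
  rw [hU, hmono.measure_iUnion]
  exact iSup_le hB

/-- The confidence intervals are simultaneously valid with probability at least `1 - γ`. -/
theorem IsBanditSampling.measure_compl_confEvent_le [IsProbabilityMeasure P]
    (h : IsBanditSampling P μ ℱ A Y) (hK : 0 < K)
    {γ : ℝ} (hγ : γ ∈ Set.Ioo (0 : ℝ) 1) : P (confEvent γ μ A Y)ᶜ ≤ ENNReal.ofReal γ := by
  have hK0 : (0 : ℝ) < K := by positivity
  have hK1 : (1 : ℝ) ≤ K := by exact_mod_cast hK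
  set g := γ / K with hg
  have hg0 : 0 < g := div_pos hγ.1 hK0
  have hg1 : g ≤ 1 := by rw [hg, div_le_one hK0]; linarith [hγ.2]
  -- For `c = ±C` with `C` the width, `s C² = 4 log (4 s / g)`, so a deviation beyond `C` makes the
  -- exponent at least `s C² / 2 = 2 log (4 s / g)`.
  set B : Fin K → ℕ → ℝ → Set Ω := fun a s c => {ω | ∃ t, draws A t ω a = s ∧
    2 * Real.log (4 * s / g) ≤ c * noiseSum A Y (μ a) t ω a - s * (c ^ 2 / 2)}
  have hsub : (confEvent γ μ A Y)ᶜ ⊆ ⋃ a, ⋃ n : ℕ,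
      (B a (n + 1) (confWidth g (n + 1 : ℕ)) ∪ B a (n + 1) (-confWidth g (n + 1 : ℕ))) := by
    intro ω hω
    simp only [confEvent, Set.mem_compl_iff, Set.mem_ofPred_eq, not_forall, not_le] at hω
    obtain ⟨t, a, h1, h2⟩ := hω
    obtain ⟨n, hn⟩ : ∃ n, draws A t ω a = n + 1 := ⟨draws A t ω a - 1, by omega⟩
    refine Set.mem_iUnion.2 ⟨a, Set.mem_iUnion.2 ⟨n, ?_⟩⟩
    have hS := noiseSum_eq A Y (μ a) h1
    rw [hn] at h2 hS
    have hs : (1 : ℝ) ≤ (n + 1 : ℕ) := by exact_mod_cast Nat.le_add_left 1 n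
    have hlog : 0 ≤ Real.log (4 * (n + 1 : ℕ) / g) :=
      Real.log_nonneg (by rw [le_div_iff₀ hg0]; linarith)
    have hC : (n + 1 : ℕ) * confWidth g (n + 1 : ℕ) ^ 2 = 4 * Real.log (4 * (n + 1 : ℕ) / g) := by
      unfold confWidth
      rw [mul_pow, Real.sq_sqrt (by positivity)]
      field_simp
      norm_num
    have hC0 : 0 < confWidth g (n + 1 : ℕ) := confWidth_pos hg0 hg1 hs
    set C := confWidth g (n + 1 : ℕ)
    rcases lt_abs.1 h2 with h3 | h3
    · refine Or.inl ⟨t, hn, ?_⟩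
      rw [hS]
      have h4 : C ≤ empMean A Y t ω a - μ a := h3.le
      have h5 : (n + 1 : ℕ) * C * C ≤ (n + 1 : ℕ) * C * (empMean A Y t ω a - μ a) := by gcongr
      linarith
    · refine Or.inr ⟨t, hn, ?_⟩
      rw [hS]
      have h4 : C ≤ -(empMean A Y t ω a - μ a) := h3.le
      have h5 : (n + 1 : ℕ) * C * C ≤ (n + 1 : ℕ) * C * -(empMean A Y t ω a - μ a) := by gcongr
      linarith
  -- Two signs, each of probability at most `(g / (4 s))²` with `s = n + 1`. The sum over `s` is `g²
  -- π² / 48 ≤ g`.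
  set q : ℕ → ℝ := fun n => g ^ 2 / 8 * (1 / ((n + 1 : ℕ) : ℝ) ^ 2)
  have hBq : ∀ a (n : ℕ), P (B a (n + 1) (confWidth g (n + 1 : ℕ)) ∪
      B a (n + 1) (-confWidth g (n + 1 : ℕ))) ≤ ENNReal.ofReal (q n) := by
    intro a n
    have hexp : Real.exp (-(2 * Real.log (4 * (n + 1 : ℕ) / g))) = q n / 2 := by
      have hpos : 0 < 4 * ((n + 1 : ℕ) : ℝ) / g := by positivity
      rw [Real.exp_neg, mul_comm, Real.exp_mul, Real.exp_log hpos]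
      simp only [q]
      norm_num
      field_simp
      norm_num
    refine (measure_union_le _ _).trans ((add_le_add (h.measure_noiseSum_le a (n + 1) _ _)
      (h.measure_noiseSum_le a (n + 1) _ _)).trans ?_)
    rw [hexp, ← ENNReal.ofReal_add (by positivity) (by positivity), add_halves]
  have hsum : HasSum q (g ^ 2 / 8 * (Real.pi ^ 2 / 6)) := by
    have h1 := ((hasSum_nat_add_iff' 1).2 hasSum_zeta_two).mul_left (g ^ 2 / 8)
    simpa [q] using h1
  have hq : ∑' n, ENNReal.ofReal (q n) ≤ ENNReal.ofReal g := by
    rw [← ENNReal.ofReal_tsum_of_nonneg (fun n => by positivity) hsum.summable, hsum.tsum_eq]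
    refine ENNReal.ofReal_le_ofReal ?_
    have h1 : Real.pi ^ 2 ≤ 4 ^ 2 := pow_le_pow_left₀ Real.pi_pos.le Real.pi_le_four 2
    nlinarith
  calc P (confEvent γ μ A Y)ᶜ ≤ _ := measure_mono hsub
    _ ≤ ∑ a : Fin K, ENNReal.ofReal g := by
      refine (measure_iUnion_fintype_le _ _).trans (Finset.sum_le_sum fun a _ => ?_)
      exact (measure_iUnion_le _).trans ((ENNReal.tsum_le_tsum (hBq a)).trans hq)
    _ = ENNReal.ofReal γ := by
      rw [← ENNReal.ofReal_sum_of_nonneg fun _ _ => hg0.le]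
      congr 1
      simp [hg]
      field_simp

end NoiseSum

end GaussianBAI

/-! ### The main theorem -/

theorem theorem1 {K : ℕ} (hK : 2 ≤ K) (γ α η R : ℝ) (hγ : γ ∈ Set.Ioo (0 : ℝ) 1)
    (hα : α ∈ Set.Icc (1 : ℝ) 2) (hη : η ∈ Set.Ioc (0 : ℝ) 1) (hR : 0 < R)
    (μ : Fin K → ℝ) (hμ : μ ∈ GaussianBAI.uniqueBestBandits K (Set.Icc 0 1))
    (T wmin : ℝ) (hT : T = GaussianBAI.charTime (Set.Icc 0 1) μ)
    (hw : wmin = GaussianBAI.minWeight (GaussianBAI.optWeights (Set.Icc 0 1) μ)) :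
    ∃ δ₀ : ℝ, 0 < δ₀ ∧
      ∀ (Ω : Type*) [mΩ : MeasurableSpace Ω] (P : Measure Ω) [IsProbabilityMeasure P]
        (ℱ : Filtration ℕ mΩ) (A : ℕ → Ω → Fin K) (Y : ℕ → Ω → ℝ) (w : ℕ → Ω → Fin K → ℝ),
        GaussianBAI.IsBanditSampling P μ ℱ A Y →
        GaussianBAI.IsExplorationBiasedSampling γ A Y w →
        ∃ E : Set Ω, MeasurableSet E ∧ ENNReal.ofReal (1 - γ) ≤ P E ∧
          ∀ δ : ℝ, 0 < δ → δ ≤ δ₀ →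
            (∀ t : ℕ, (1 + η) * T * Real.log (1 / δ) < (t : ℝ) →
              P ({ω | (t : ℕ∞) < GaussianBAI.stopTime A Y R α δ ω} ∩ E) ≤
                ENNReal.ofReal (2 * (K : ℝ) * (t : ℝ) *
                  Real.exp (-((t : ℝ) * wmin / (4 * T ^ 2) *
                    (1 / Real.log (1 / δ) ^ (2 / 3 : ℝ)))))) ∧
            ∫⁻ ω in E, ((GaussianBAI.stopTime A Y R α δ ω : ℕ∞) : ENNReal) ∂P ≤
              ENNReal.ofReal ((1 + η) * T * Real.log (1 / δ) +
                2 ^ 7 * (K : ℝ) * T ^ 4 / wmin ^ 2 *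
                  Real.exp (-(wmin / (4 * T) * Real.log (1 / δ) ^ (1 / 3 : ℝ))) *
                  Real.log (1 / δ) ^ 2) := by
  obtain ⟨hμ01, a, ha⟩ := hμ
  obtain ⟨hT0, v, hv, hvT⟩ := GaussianBAI.charTime_pos hK ha
  rw [← hT] at hT0 hvT
  have hTinv : 0 < T⁻¹ := inv_pos.2 hT0
  have hη0 := hη.1
  obtain ⟨t₀, hKt₀, ht₀⟩ := GaussianBAI.exists_le_glr hK hγ hμ01 ha hv (hvT ▸ hTinv.le)
    (ε := η / 8 * T⁻¹) (by positivity)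
  obtain ⟨L₀, hL₀, hthr⟩ := GaussianBAI.exists_threshold_lt (α := α) hT0 hη hR t₀
  -- The second term ensures `η T log (1/δ) / 2 ≥ 1`, which pays for rounding the stopping bound up
  -- to an integer.
  refine ⟨Real.exp (-(max L₀ (2 / (η * T)))), Real.exp_pos _, ?_⟩
  intro Ω mΩ P _ ℱ A Y w hs hrule
  set G := GaussianBAI.confEvent γ μ A Y
  have hG : P (toMeasurable P Gᶜ) ≤ ENNReal.ofReal γ := by
    rw [measure_toMeasurable]
    exact hs.measure_compl_confEvent_le (by omega) hγ
  have hEG : (toMeasurable P Gᶜ)ᶜ ⊆ G := Set.compl_subset_comm.1 (subset_toMeasurable P Gᶜ)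
  have hEm : MeasurableSet (toMeasurable P Gᶜ)ᶜ := (measurableSet_toMeasurable P Gᶜ).compl
  -- A measurable event inside the confidence event, chosen before `δ`.
  refine ⟨(toMeasurable P Gᶜ)ᶜ, hEm, ?_, fun δ hδ hδ₀ => ?_⟩
  · rw [prob_compl_eq_one_sub (measurableSet_toMeasurable P Gᶜ),
      ENNReal.ofReal_sub _ hγ.1.le, ENNReal.ofReal_one]
    exact tsub_le_tsub_left hG 1
  have hL : max L₀ (2 / (η * T)) ≤ Real.log (1 / δ) := by
    rw [one_div, Real.log_inv]
    have := (Real.log_le_iff_le_exp hδ).2 hδ₀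
    linarith
  set L := Real.log (1 / δ)
  have hLL₀ : L₀ ≤ L := (le_max_left _ _).trans hL
  have hL2 : 2 ≤ L * (η * T) := by
    rw [← div_le_iff₀ (by positivity)]
    exact (le_max_right _ _).trans hL
  have hL0 : 0 < L := hL₀.trans_le hLL₀
  have hbound : ∀ t : ℕ, (1 + η / 2) * T * L < t → ∀ ω ∈ (toMeasurable P Gᶜ)ᶜ,
      GaussianBAI.stopTime A Y R α δ ω ≤ t := by
    intro t ht ω hω
    obtain ⟨h1, h2⟩ := hthr δ hδ hLL₀ t ht
    have h3 := ht₀ t h1 hrule ω (hEG hω)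
    rw [hvT] at h3
    exact iInf_le (fun t : {t : ℕ // K ≤ t ∧ GaussianBAI.threshold R α t δ <
      GaussianBAI.glr A Y t ω} => ((t : ℕ) : ℕ∞)) ⟨t, hKt₀.trans h1, h2.trans_le h3⟩
  refine ⟨fun t ht => ?_, ?_⟩
  · have hempty : {ω | (t : ℕ∞) < GaussianBAI.stopTime A Y R α δ ω} ∩ (toMeasurable P Gᶜ)ᶜ = ∅ := by
      refine Set.eq_empty_of_forall_notMem fun ω hω => ?_
      refine absurd hω.1 (not_lt.2 (hbound t (lt_of_le_of_lt ?_ ht) ω hω.2))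
      gcongr
      linarith
    rw [hempty, measure_empty]
    exact zero_le
  · have hx : 0 ≤ (1 + η / 2) * T * L := by positivity
    set n := ⌊(1 + η / 2) * T * L⌋₊ + 1
    have hn : (1 + η / 2) * T * L < n := by exact_mod_cast Nat.lt_floor_add_one _
    have hn' : (n : ℝ) ≤ (1 + η) * T * L := by
      have := Nat.floor_le hx
      simp only [n]
      push_cast
      linarith
    calc ∫⁻ ω in (toMeasurable P Gᶜ)ᶜ, ((GaussianBAI.stopTime A Y R α δ ω : ℕ∞) : ENNReal) ∂P
        ≤ ∫⁻ _ in (toMeasurable P Gᶜ)ᶜ, (n : ENNReal) ∂P :=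
          setLIntegral_mono' hEm fun ω hω => by
            have := ENat.toENNReal_le.2 (hbound n hn ω hω)
            simpa using this
      _ ≤ n := by
        rw [setLIntegral_const]
        exact mul_le_of_le_one_right' prob_le_one
      _ = ENNReal.ofReal n := (ENNReal.ofReal_natCast n).symm
      _ ≤ _ := by
        refine ENNReal.ofReal_le_ofReal (hn'.trans (le_add_of_nonneg_right ?_))
        positivity
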